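/- Let $M$ be a closed smooth manifold of dimension $2n+1$ ($n\ge 0$) with a co-oriented contact structure $\xi=\ker\alpha$, where $\alpha$ is a contact form defining $\xi$ and its co-orientation. A contact isotopy is a smooth path $\phi=\{\phi_t\}_{t\in[0,1]}$ of contactomorphisms of $(M,\xi)$ with $\phi_0=\mathrm{id}$; its contact Hamiltonian $h_\alpha(\phi):[0,1]\times M\to\mathbb R$ is given by $h_\alpha(\phi)(t,\phi_t(x))=\alpha\big(\tfrac{d}{dt}\phi_t(x)\big)$, and $\phi$ is positive if $h_\alpha(\phi)>0$ everywhere. Let $\widetilde{\mathrm{Cont}}_0(M,\xi)$ be the set of contact isotopies modulo (smooth) homotopy with fixed endpoints through contact isotopies, and write $\mathbb 1$ for the class of the constant isotopy. Let $\overrightarrow{G}$ be the set of positive contact isotopies modulo (smooth) homotopy with fixed endpoints through positive contact isotopies; it is a semigroup under $[\phi][\psi]=[\{\phi_t\circ\psi_t\}_{t\in[0,1]}]$. Let $\pi:\overrightarrow{G}\to\widetilde{\mathrm{Cont}}_0(M,\xi)$ be the natural projection. Assume that $(M,\xi)$ is orderable, that is, $\mathbb 1\notin\pi(\overrightarrow{G})$.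 For $a,b\in\overrightarrow{G}$ write $a\ge_+ b$ if $a=b$ or $a=bc$ for some $c\in\overrightarrow{G}$. For $A,B\in\widetilde{\mathrm{Cont}}_0(M,\xi)$ write $A\ge_o B$ if there are representatives $\phi$ of $A$ and $\psi$ of $B$ with $h_\alpha(\phi)\ge h_\alpha(\psi)$ pointwise on $[0,1]\times M$. Then $\ge_+$ is a bi-invariant partial order on $\overrightarrow{G}$: it is reflexive, antisymmetric and transitive, and $a\ge_+ b$ implies $ac\ge_+ bc$ and $ca\ge_+ cb$ for all $c\in\overrightarrow{G}$. Moreover $\pi$ is monotone: if $a\ge_+ b$, then $\pi(a)\ge_o\pi(b)$. -/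

import Mathlib

open scoped Manifold ContDiff
open Set

namespace ContactOrder

section Forms

variable {n : ℕ} {M : Type*} [TopologicalSpace M]
  [ChartedSpace (EuclideanSpace ℝ (Fin (2 * n + 1))) M]
  [IsManifold (𝓡 (2 * n + 1)) ∞ M]

/-- The local representative of a field of covectors `a` in the preferred chart at `x`: the
pull-back of `a` under the inverse of that chart, a `1`-form on (an open part of) `ℝ^(2n+1)`. -/
noncomputable def localRep
    (a : ∀ x : M, TangentSpace (𝓡 (2 * n + 1)) x →L[ℝ] ℝ) (x : M)
    (y : EuclideanSpace ℝ (Fin (2 * n + 1))) :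
    EuclideanSpace ℝ (Fin (2 * n + 1)) →L[ℝ] ℝ :=
  (a ((extChartAt (𝓡 (2 * n + 1)) x).symm y)).comp
    (mfderiv 𝓘(ℝ, EuclideanSpace ℝ (Fin (2 * n + 1))) (𝓡 (2 * n + 1))
      (extChartAt (𝓡 (2 * n + 1)) x).symm y)

/-- The exterior derivative `da` of a `1`-form `a` at the point `x`, computed in the preferred chart
at `x`: `da(u, v) = D a(u)(v) - D a(v)(u)`. In Mathlib the tangent space at `x` is the model space,
the identification being the derivative of the preferred chart at `x`; so `u` and `v` are their own
coordinate vectors. -/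
noncomputable def exteriorDeriv
    (a : ∀ x : M, TangentSpace (𝓡 (2 * n + 1)) x →L[ℝ] ℝ) (x : M)
    (u v : TangentSpace (𝓡 (2 * n + 1)) x) : ℝ :=
  (fderiv ℝ (localRep a x) (extChartAt (𝓡 (2 * n + 1)) x x)
      (show EuclideanSpace ℝ (Fin (2 * n + 1)) from u))
      (show EuclideanSpace ℝ (Fin (2 * n + 1)) from v)
    - (fderiv ℝ (localRep a x) (extChartAt (𝓡 (2 * n + 1)) x x)
      (show EuclideanSpace ℝ (Fin (2 * n + 1)) from v))
      (show EuclideanSpace ℝ (Fin (2 * n + 1)) from u)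

variable (n M) in
/-- A contact form on a `(2n+1)`-dimensional manifold `M`: a smooth nowhere vanishing `1`-form `α`
such that `dα` is nondegenerate on each hyperplane `ker α_x` (that is, `α ∧ (dα)^n` has no zero).
A co-oriented contact structure is `ξ = ker α` for such an `α`, co-oriented by the side on which
`α` is positive. All notions below depend on `α` only through `ξ` and its co-orientation. -/
structure ContactForm where
  toFun : ∀ x : M, TangentSpace (𝓡 (2 * n + 1)) x →L[ℝ] ℝ
  smooth : ContMDiff (𝓡 (2 * n + 1))
    ((𝓡 (2 * n + 1)).prod 𝓘(ℝ, EuclideanSpace ℝ (Fin (2 * n + 1)) →L[ℝ] ℝ)) ∞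
    (fun x => Bundle.TotalSpace.mk' (EuclideanSpace ℝ (Fin (2 * n + 1)) →L[ℝ] ℝ)
      (E := fun x => TangentSpace (𝓡 (2 * n + 1)) x →L[ℝ] Bundle.Trivial M ℝ x) x (toFun x))
  ne_zero : ∀ x, toFun x ≠ 0
  nondegenerate : ∀ (x : M) (u : TangentSpace (𝓡 (2 * n + 1)) x), toFun x u = 0 →
    (∀ v : TangentSpace (𝓡 (2 * n + 1)) x, toFun x v = 0 → exteriorDeriv toFun x u v = 0) → u = 0

/-- A contactomorphism of `(M, ξ = ker α)` (preserving the co-orientation): a smooth diffeomorphism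
`f` with `f^* α = c · α` for a positive function `c`. -/
structure Contactomorphism (α : ContactForm n M) where
  toDiffeo : M ≃ₘ⟮𝓡 (2 * n + 1), 𝓡 (2 * n + 1)⟯ M
  conformal : ∀ x : M, ∃ c : ℝ, 0 < c ∧ ∀ v : TangentSpace (𝓡 (2 * n + 1)) x,
    α.toFun (toDiffeo x) (mfderiv (𝓡 (2 * n + 1)) (𝓡 (2 * n + 1)) toDiffeo x v)
      = c * α.toFun x v

end Forms

namespace Contactomorphism

variable {n : ℕ} {M : Type*} [TopologicalSpace M]
  [ChartedSpace (EuclideanSpace ℝ (Fin (2 * n + 1))) M]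
  [IsManifold (𝓡 (2 * n + 1)) ∞ M] {α : ContactForm n M}

@[ext] theorem ext {f g : Contactomorphism α} (h : ∀ x, f.toDiffeo x = g.toDiffeo x) : f = g := by
  cases f; cases g; congr; exact Diffeomorph.ext h

/-- The identity. -/
noncomputable instance : One (Contactomorphism α) where
  one :=
    { toDiffeo := Diffeomorph.refl _ M ∞
      conformal := fun x => ⟨1, one_pos, fun v => by
        rw [one_mul]
        have h : mfderiv (𝓡 (2 * n + 1)) (𝓡 (2 * n + 1))
            (⇑(Diffeomorph.refl (𝓡 (2 * n + 1)) M ∞)) x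
            = ContinuousLinearMap.id ℝ (TangentSpace (𝓡 (2 * n + 1)) x) := mfderiv_id
        rw [h]; rfl⟩ }

/-- Composition: `(f * g)(x) = f(g(x))`. -/
noncomputable instance : Mul (Contactomorphism α) where
  mul f g :=
    { toDiffeo := g.toDiffeo.trans f.toDiffeo
      conformal := fun x => by
        obtain ⟨c, hc, hcv⟩ := g.conformal x
        obtain ⟨d, hd, hdv⟩ := f.conformal (g.toDiffeo x)
        refine ⟨d * c, mul_pos hd hc, fun v => ?_⟩
        have h : mfderiv (𝓡 (2 * n + 1)) (𝓡 (2 * n + 1)) (⇑(g.toDiffeo.trans f.toDiffeo)) x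
            = (mfderiv (𝓡 (2 * n + 1)) (𝓡 (2 * n + 1)) f.toDiffeo (g.toDiffeo x)).comp
              (mfderiv (𝓡 (2 * n + 1)) (𝓡 (2 * n + 1)) g.toDiffeo x) :=
          mfderiv_comp x (f.toDiffeo.mdifferentiable (by simp) _)
            (g.toDiffeo.mdifferentiable (by simp) _)
        rw [h, mul_assoc, ← hcv v]
        exact hdv _ }

@[simp] theorem one_apply (x : M) : (1 : Contactomorphism α).toDiffeo x = x := rfl

@[simp] theorem mul_apply (f g : Contactomorphism α) (x : M) :
    (f * g).toDiffeo x = f.toDiffeo (g.toDiffeo x) := rfl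

@[simp] theorem mul_symm_apply (f g : Contactomorphism α) (x : M) :
    (f * g).toDiffeo.symm x = g.toDiffeo.symm (f.toDiffeo.symm x) := rfl

end Contactomorphism

section Isotopies

variable {n : ℕ} {M : Type*} [TopologicalSpace M]
  [ChartedSpace (EuclideanSpace ℝ (Fin (2 * n + 1))) M]
  [IsManifold (𝓡 (2 * n + 1)) ∞ M]

/-- The point of `[0,1]` nearest to `t`, used to write maps on `[0,1]` as maps on `ℝ`. Smoothness
and derivatives are only ever taken within `[0,1]`, where this is the identity. -/
noncomputable abbrev toI (t : ℝ) : unitInterval := projIcc 0 1 zero_le_one t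

/-- A contact isotopy: a smooth path, parametrized by `[0,1]`, in the group of contactomorphisms
that starts at the identity. Smoothness means that `(t, x) ↦ φ_t(x)` and `(t, x) ↦ φ_t⁻¹(x)` are
smooth on `[0,1] × M` (the latter follows from the former by the inverse function theorem). -/
structure ContactIsotopy (α : ContactForm n M) where
  path : unitInterval → Contactomorphism α
  path_zero : path 0 = 1
  smooth : ContMDiffOn (𝓘(ℝ, ℝ).prod (𝓡 (2 * n + 1))) (𝓡 (2 * n + 1)) ∞
    (fun p : ℝ × M => (path (toI p.1)).toDiffeo p.2) (Icc (0 : ℝ) 1 ×ˢ univ)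
  smooth_symm : ContMDiffOn (𝓘(ℝ, ℝ).prod (𝓡 (2 * n + 1))) (𝓡 (2 * n + 1)) ∞
    (fun p : ℝ × M => (path (toI p.1)).toDiffeo.symm p.2) (Icc (0 : ℝ) 1 ×ˢ univ)

namespace ContactIsotopy

variable {α : ContactForm n M}

@[ext] theorem ext {φ ψ : ContactIsotopy α} (h : ∀ t, φ.path t = ψ.path t) : φ = ψ := by
  cases φ; cases ψ; congr; exact funext h

/-- The velocity `d/dt φ_t(x)` (one-sided at `t = 0` and `t = 1`), a tangent vector at `φ_t(x)`. -/
noncomputable def velocity (φ : ContactIsotopy α) (t : unitInterval) (x : M) :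
    TangentSpace (𝓡 (2 * n + 1)) ((φ.path (toI (t : ℝ))).toDiffeo x) :=
  mfderivWithin 𝓘(ℝ, ℝ) (𝓡 (2 * n + 1)) (fun τ : ℝ => (φ.path (toI τ)).toDiffeo x)
    (Icc (0 : ℝ) 1) (t : ℝ) (1 : ℝ)

/-- The contact Hamiltonian `h_α(φ) : [0,1] × M → ℝ` of a contact isotopy:
`h_α(φ)(t, φ_t(x)) = α(d/dt φ_t(x))`. -/
noncomputable def hamiltonian (φ : ContactIsotopy α) (t : unitInterval) (y : M) : ℝ :=
  α.toFun ((φ.path (toI (t : ℝ))).toDiffeo ((φ.path t).toDiffeo.symm y))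
    (φ.velocity t ((φ.path t).toDiffeo.symm y))

/-- A contact isotopy is positive if its contact Hamiltonian is pointwise positive. -/
def IsPositive (φ : ContactIsotopy α) : Prop :=
  ∀ (t : unitInterval) (y : M), 0 < φ.hamiltonian t y

/-- `φ` and `ψ` have the same end point and are (smoothly) homotopic with fixed end points through
contact isotopies that satisfy `P`. -/
def HomotopicThrough (P : ContactIsotopy α → Prop) (φ ψ : ContactIsotopy α) : Prop :=
  φ.path 1 = ψ.path 1 ∧
  ∃ H : unitInterval → ContactIsotopy α, H 0 = φ ∧ H 1 = ψ ∧ (∀ s, (H s).path 1 = φ.path 1) ∧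
    (∀ s, P (H s)) ∧
    ContMDiffOn (𝓘(ℝ, ℝ).prod (𝓘(ℝ, ℝ).prod (𝓡 (2 * n + 1)))) (𝓡 (2 * n + 1)) ∞
      (fun p : ℝ × ℝ × M => ((H (toI p.1)).path (toI p.2.1)).toDiffeo p.2.2)
      (Icc (0 : ℝ) 1 ×ˢ (Icc (0 : ℝ) 1 ×ˢ univ))

/-- The constant isotopy at the identity. -/
noncomputable instance : One (ContactIsotopy α) where
  one :=
    { path := fun _ => 1
      path_zero := rfl
      smooth := contMDiff_snd.contMDiffOn
      smooth_symm := contMDiff_snd.contMDiffOn }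

/-- The pointwise product `(φ ψ)_t = φ_t ∘ ψ_t`. -/
noncomputable instance : Mul (ContactIsotopy α) where
  mul φ ψ :=
    { path := fun t => φ.path t * ψ.path t
      path_zero := by rw [φ.path_zero, ψ.path_zero]; rfl
      smooth := φ.smooth.comp (contMDiff_fst.contMDiffOn.prodMk ψ.smooth)
        (fun p hp => ⟨hp.1, mem_univ _⟩)
      smooth_symm := ψ.smooth_symm.comp (contMDiff_fst.contMDiffOn.prodMk φ.smooth_symm)
        (fun p hp => ⟨hp.1, mem_univ _⟩) }

@[simp] theorem mul_path (φ ψ : ContactIsotopy α) (t : unitInterval) :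
    (φ * ψ).path t = φ.path t * ψ.path t := rfl

protected theorem mul_assoc (φ ψ θ : ContactIsotopy α) : φ * ψ * θ = φ * (ψ * θ) :=
  ContactIsotopy.ext fun _ => Contactomorphism.ext fun _ => rfl

theorem toI_coe (t : unitInterval) : toI (t : ℝ) = t := projIcc_val zero_le_one t

theorem path_mdiff (φ : ContactIsotopy α) (t : unitInterval) (x : M) :
    MDifferentiableWithinAt (𝓘(ℝ, ℝ).prod (𝓡 (2 * n + 1))) (𝓡 (2 * n + 1))
      (fun p : ℝ × M => (φ.path (toI p.1)).toDiffeo p.2) (Icc (0 : ℝ) 1 ×ˢ univ) ((t : ℝ), x) :=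
  (φ.smooth ((t : ℝ), x) ⟨t.2, mem_univ _⟩).mdifferentiableWithinAt (by simp)

theorem hasMFDerivWithinAt_velocity (φ : ContactIsotopy α) (t : unitInterval) (x : M) :
    HasMFDerivWithinAt 𝓘(ℝ, ℝ) (𝓡 (2 * n + 1)) (fun τ : ℝ => (φ.path (toI τ)).toDiffeo x)
      (Icc (0 : ℝ) 1) (t : ℝ)
      (mfderivWithin 𝓘(ℝ, ℝ) (𝓡 (2 * n + 1)) (fun τ : ℝ => (φ.path (toI τ)).toDiffeo x)
        (Icc (0 : ℝ) 1) (t : ℝ)) := by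
  apply MDifferentiableWithinAt.hasMFDerivWithinAt
  have h := φ.smooth.comp
    (contMDiff_id.prodMk (contMDiff_const (c := x))).contMDiffOn
    (fun (τ : ℝ) (hτ : τ ∈ Icc (0 : ℝ) 1) => (⟨hτ, mem_univ _⟩ : (τ, x) ∈ Icc (0 : ℝ) 1 ×ˢ univ))
  exact (h (t : ℝ) t.2).mdifferentiableWithinAt (by simp)

/-- Chain rule for `d/dt φ_t(ψ_t(x))`. -/
theorem velocity_mul (φ ψ : ContactIsotopy α) (t : unitInterval) (x : M) :
    (φ * ψ).velocity t x = φ.velocity t ((ψ.path (toI (t : ℝ))).toDiffeo x)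
      + mfderiv (𝓡 (2 * n + 1)) (𝓡 (2 * n + 1)) (φ.path (toI (t : ℝ))).toDiffeo
          ((ψ.path (toI (t : ℝ))).toDiffeo x) (ψ.velocity t x) := by
  set y := (ψ.path (toI (t : ℝ))).toDiffeo x with hy
  have hU : UniqueMDiffWithinAt 𝓘(ℝ, ℝ) (Icc (0 : ℝ) 1) (t : ℝ) :=
    (uniqueDiffOn_Icc zero_lt_one (t : ℝ) t.2).uniqueMDiffWithinAt
  have hD := (φ.path_mdiff t y).hasMFDerivWithinAt
  set D := mfderivWithin (𝓘(ℝ, ℝ).prod (𝓡 (2 * n + 1))) (𝓡 (2 * n + 1))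
      (fun p : ℝ × M => (φ.path (toI p.1)).toDiffeo p.2) (Icc (0 : ℝ) 1 ×ˢ univ) ((t : ℝ), y)
  -- the time direction
  have h1 : φ.velocity t y = D ((1 : ℝ), (0 : EuclideanSpace ℝ (Fin (2 * n + 1)))) := by
    have h := HasMFDerivWithinAt.comp (t : ℝ)
      (g := fun p : ℝ × M => (φ.path (toI p.1)).toDiffeo p.2) (f := fun τ : ℝ => (τ, y)) hD
      ((hasMFDerivWithinAt_id (I := 𝓘(ℝ, ℝ)) (Icc (0 : ℝ) 1) (t : ℝ)).prodMk
        (hasMFDerivWithinAt_const (I' := 𝓡 (2 * n + 1)) y (Icc (0 : ℝ) 1) (t : ℝ)))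
      (fun τ hτ => ⟨hτ, mem_univ _⟩)
    have h' := hU.eq (φ.hasMFDerivWithinAt_velocity t y) h
    exact congrArg (fun L => L (1 : ℝ)) h'
  -- the space direction
  have h2 : ∀ v : EuclideanSpace ℝ (Fin (2 * n + 1)),
      mfderiv (𝓡 (2 * n + 1)) (𝓡 (2 * n + 1)) (φ.path (toI (t : ℝ))).toDiffeo y v
        = D ((0 : ℝ), v) := by
    intro v
    have h := HasMFDerivWithinAt.comp y
      (g := fun p : ℝ × M => (φ.path (toI p.1)).toDiffeo p.2) (f := fun z : M => ((t : ℝ), z)) hD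
      ((hasMFDerivWithinAt_const (I := 𝓡 (2 * n + 1)) (I' := 𝓘(ℝ, ℝ)) (t : ℝ) univ y).prodMk
        (hasMFDerivWithinAt_id (I := 𝓡 (2 * n + 1)) univ y))
      (fun z _ => ⟨t.2, mem_univ _⟩)
    rw [hasMFDerivWithinAt_univ] at h
    have h' := hasMFDerivAt_unique
      ((φ.path (toI (t : ℝ))).toDiffeo.mdifferentiable (by simp) y).hasMFDerivAt h
    exact congrArg (fun L => L v) h'
  have h3 : (φ * ψ).velocity t x = D ((1 : ℝ), ψ.velocity t x) := by
    have h := HasMFDerivWithinAt.comp (t : ℝ)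
      (g := fun p : ℝ × M => (φ.path (toI p.1)).toDiffeo p.2)
      (f := fun τ : ℝ => (τ, (ψ.path (toI τ)).toDiffeo x)) hD
      ((hasMFDerivWithinAt_id (I := 𝓘(ℝ, ℝ)) (Icc (0 : ℝ) 1) (t : ℝ)).prodMk
        (ψ.hasMFDerivWithinAt_velocity t x))
      (fun τ hτ => ⟨hτ, mem_univ _⟩)
    have h' := hU.eq ((φ * ψ).hasMFDerivWithinAt_velocity t x) h
    exact congrArg (fun L => L (1 : ℝ)) h'
  have h4 : D ((1 : ℝ), ψ.velocity t x)
      = D ((1 : ℝ), (0 : EuclideanSpace ℝ (Fin (2 * n + 1)))) + D ((0 : ℝ), ψ.velocity t x) := by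
    refine Eq.trans ?_ (D.map_add _ _)
    congr 1
    exact Prod.ext (add_zero (1 : ℝ)).symm
      (zero_add (M := EuclideanSpace ℝ (Fin (2 * n + 1))) (ψ.velocity t x)).symm
  exact h3.trans (h4.trans (congrArg₂ (· + ·) h1.symm (h2 _).symm))

theorem isPositive_iff {φ : ContactIsotopy α} : φ.IsPositive ↔ ∀ (t : unitInterval) (x : M),
    0 < α.toFun ((φ.path (toI (t : ℝ))).toDiffeo x) (φ.velocity t x) := by
  constructor
  · intro h t x
    have := h t ((φ.path t).toDiffeo x)
    unfold hamiltonian at this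
    rwa [Diffeomorph.symm_apply_apply] at this
  · intro h t y
    exact h t _

theorem IsPositive.mul {φ ψ : ContactIsotopy α} (hφ : φ.IsPositive) (hψ : ψ.IsPositive) :
    (φ * ψ).IsPositive := by
  rw [isPositive_iff] at *
  intro t x
  obtain ⟨c, hc, hcv⟩ :=
    (φ.path (toI (t : ℝ))).conformal ((ψ.path (toI (t : ℝ))).toDiffeo x)
  have h := add_pos (hφ t ((ψ.path (toI (t : ℝ))).toDiffeo x)) (mul_pos hc (hψ t x))
  rw [← hcv, ← map_add, ← velocity_mul] at h
  exact h

theorem HomotopicThrough.mul_left {P Q : ContactIsotopy α → Prop} (θ : ContactIsotopy α)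
    (hPQ : ∀ φ, P φ → Q (θ * φ)) {φ ψ : ContactIsotopy α} (h : HomotopicThrough P φ ψ) :
    HomotopicThrough Q (θ * φ) (θ * ψ) := by
  obtain ⟨h1, H, h2, h3, h4, h5, h6⟩ := h
  refine ⟨by simp [h1], fun s => θ * H s, by simp [h2], by simp [h3], fun s => by simp [h4],
    fun s => hPQ _ (h5 s), ?_⟩
  exact θ.smooth.comp ((contMDiff_fst.comp contMDiff_snd).contMDiffOn.prodMk h6)
    (fun p hp => ⟨hp.2.1, mem_univ _⟩)

theorem HomotopicThrough.mul_right {P Q : ContactIsotopy α → Prop} (θ : ContactIsotopy α)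
    (hPQ : ∀ φ, P φ → Q (φ * θ)) {φ ψ : ContactIsotopy α} (h : HomotopicThrough P φ ψ) :
    HomotopicThrough Q (φ * θ) (ψ * θ) := by
  obtain ⟨h1, H, h2, h3, h4, h5, h6⟩ := h
  refine ⟨by simp [h1], fun s => H s * θ, by simp [h2], by simp [h3], fun s => by simp [h4],
    fun s => hPQ _ (h5 s), ?_⟩
  have hθ := θ.smooth.comp
    (contMDiff_snd (I := 𝓘(ℝ, ℝ)) (J := 𝓘(ℝ, ℝ).prod (𝓡 (2 * n + 1))) (M := ℝ)
      (N := ℝ × M) (n := ∞)).contMDiffOn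
    (fun (p : ℝ × ℝ × M) (hp : p ∈ Icc (0 : ℝ) 1 ×ˢ (Icc (0 : ℝ) 1 ×ˢ (univ : Set M))) => hp.2)
  exact h6.comp (contMDiff_fst.contMDiffOn.prodMk
    ((contMDiff_fst.comp contMDiff_snd).contMDiffOn.prodMk hθ))
    (fun p hp => ⟨hp.1, hp.2.1, mem_univ _⟩)

theorem HomotopicThrough.mono {P Q : ContactIsotopy α → Prop} (hPQ : ∀ φ, P φ → Q φ)
    {φ ψ : ContactIsotopy α} (h : HomotopicThrough P φ ψ) : HomotopicThrough Q φ ψ := by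
  obtain ⟨h1, H, h2, h3, h4, h5, h6⟩ := h
  exact ⟨h1, H, h2, h3, h4, fun s => hPQ _ (h5 s), h6⟩

end ContactIsotopy

open ContactIsotopy

/-- Positive contact isotopies. -/
abbrev PosIsotopy (α : ContactForm n M) := {φ : ContactIsotopy α // φ.IsPositive}

/-- The semigroup of positive contact isotopies modulo homotopy with fixed end points through
positive contact isotopies. -/
def PosClass (α : ContactForm n M) : Type _ :=
  Quot fun φ ψ : PosIsotopy α => HomotopicThrough IsPositive φ.1 ψ.1

/-- `\widetilde{Cont}_0(M, ξ)`: contact isotopies modulo homotopy with fixed end points. -/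
def IsotopyClass (α : ContactForm n M) : Type _ :=
  Quot fun φ ψ : ContactIsotopy α => HomotopicThrough (fun _ => True) φ ψ

/-- The class of the constant isotopy. -/
noncomputable instance (α : ContactForm n M) : One (IsotopyClass α) := ⟨Quot.mk _ 1⟩

/-- `[φ][ψ] = [φ_t ∘ ψ_t]`. -/
noncomputable instance (α : ContactForm n M) : Semigroup (PosClass α) where
  mul := Quot.map₂ (fun φ ψ : PosIsotopy α => (⟨φ.1 * ψ.1, φ.2.mul ψ.2⟩ : PosIsotopy α))
    (fun φ _ _ h => h.mul_left φ.1 fun _ hP => φ.2.mul hP)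
    (fun _ _ ψ h => h.mul_right ψ.1 fun _ hP => hP.mul ψ.2)
  mul_assoc := by
    rintro ⟨φ⟩ ⟨ψ⟩ ⟨θ⟩
    exact congrArg (Quot.mk _) (Subtype.ext (ContactIsotopy.mul_assoc φ.1 ψ.1 θ.1))

/-- The natural projection from classes of positive isotopies to `\widetilde{Cont}_0(M, ξ)`. -/
def proj (α : ContactForm n M) : PosClass α → IsotopyClass α :=
  Quot.map Subtype.val fun _ _ h => h.mono fun _ _ => trivial

/-- `(M, ξ)` is orderable if no class of positive isotopies projects to the identity class. -/
def IsOrderable (α : ContactForm n M) : Prop :=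
  (1 : IsotopyClass α) ∉ Set.range (proj α)

/-- The relation `a ≥₊ b`: `a = b` or `a = bc` for some class `c` of positive isotopies. -/
def GePos {α : ContactForm n M} (a b : PosClass α) : Prop :=
  a = b ∨ ∃ c : PosClass α, a = b * c

/-- The relation `a ≥ₒ b`: there are representatives `φ` of `a` and `ψ` of `b` with
`h_α(φ) ≥ h_α(ψ)` pointwise. -/
def GeOrd {α : ContactForm n M} (a b : IsotopyClass α) : Prop :=
  ∃ φ ψ : ContactIsotopy α, Quot.mk _ φ = a ∧ Quot.mk _ ψ = b ∧
    ∀ (t : unitInterval) (y : M), ψ.hamiltonian t y ≤ φ.hamiltonian t y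

end Isotopies

/-- A relation `r` (read `a ≥ b` for `r a b`) on a semigroup is a bi-invariant partial order if it
is a partial order that is preserved by left and by right multiplication. -/
structure IsBiInvariantPartialOrder {S : Type*} [Semigroup S] (r : S → S → Prop) : Prop where
  refl : ∀ a, r a a
  antisymm : ∀ a b, r a b → r b a → a = b
  trans : ∀ a b c, r a b → r b c → r a c
  mul_right : ∀ a b c, r a b → r (a * c) (b * c)
  mul_left : ∀ a b c, r a b → r (c * a) (c * b)

end ContactOrder

/-! Reflexivity, transitivity and left invariance are formal. The content lies in two facts about
the semigroup of positive classes.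

Antisymmetry: `a = bc` and `b = ad` give `b = b(cd)`. After projecting to contact isotopies, where
the pointwise inverse of a representative of `b` exists, this cancels to `π(cd) = 1`, which
orderability forbids (`PosClass.mul_ne_self`).

Right invariance: from `a = bd` one needs `bdc = bcd'`, so a positive class must be movable past
another, `dc = cd'` (`PosClass.exists_mul_eq_mul`). The pointwise conjugate `θ_t⁻¹ ψ_t θ_t` need not
be positive: its Hamiltonian has a good part from the velocity of `ψ` and an error measuring how far
`ψ_t` fails to preserve the Hamiltonian of `θ`. Replace `ψ_t` by `ψ_{u(t)}`, which is homotopic to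
it through positive isotopies. By compactness the good part is at least `c · u'(t)` with `c > 0`,
and the error is at most `C · u(t)` because it vanishes for `ψ_0 = id`. An exponential `u` with `u'
> K u` and `K` large makes the conjugate positive (`IsPositive.exists_conj`).

Monotonicity of the projection is pointwise: composing on the right with a positive isotopy
increases the Hamiltonian (`hamiltonian_le_mul`). -/

namespace ContactOrder

/-! ### Smooth dependence of time derivatives, and bounds uniform in space -/

section TimeDerivative

variable {E H N E' H' P : Type*} [NormedAddCommGroup E] [NormedSpace ℝ E] [TopologicalSpace H]
  {J : ModelWithCorners ℝ E H} [TopologicalSpace N] [ChartedSpace H N] [IsManifold J ∞ N]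
  [NormedAddCommGroup E'] [NormedSpace ℝ E'] [TopologicalSpace H'] {J' : ModelWithCorners ℝ E' H'}
  [TopologicalSpace P] [ChartedSpace H' P] [IsManifold J' ∞ P]

/-- The bundled time derivative of a smooth family of curves is smooth. -/
theorem contMDiffOn_timeDeriv {S : Set N} (hS : UniqueMDiffOn J S) {F : ℝ × N → P}
    (hF : ContMDiffOn (𝓘(ℝ, ℝ).prod J) J' ∞ F (Icc (0 : ℝ) 1 ×ˢ S)) :
    ContMDiffOn (𝓘(ℝ, ℝ).prod J) J'.tangent ∞
      (fun p => (⟨F p, mfderivWithin 𝓘(ℝ, ℝ) J' (fun τ : ℝ => F (τ, p.2)) (Icc (0 : ℝ) 1) p.1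
        (1 : ℝ)⟩ : TangentBundle J' P)) (Icc (0 : ℝ) 1 ×ˢ S) := by
  have : IsManifold J 1 N := IsManifold.of_le (n := ∞) (by simp)
  have : IsManifold J' 1 P := IsManifold.of_le (n := ∞) (by simp)
  have hI : UniqueMDiffOn 𝓘(ℝ, ℝ) (Icc (0 : ℝ) 1) :=
    (uniqueDiffOn_Icc zero_lt_one).uniqueMDiffOn
  have hU : UniqueMDiffOn (𝓘(ℝ, ℝ).prod J) (Icc (0 : ℝ) 1 ×ˢ S) := hI.prod hS
  -- The time derivative is the tangent map of `F` applied to the smooth vector field `(∂_t, 0)` on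
  -- the product.
  have hT := hF.contMDiffOn_tangentMapWithin (m := ∞) (by simp) hU
  have h1 : ContMDiff 𝓘(ℝ, ℝ) 𝓘(ℝ, ℝ).tangent ∞
      (fun t : ℝ => (⟨t, (1 : ℝ)⟩ : TangentBundle 𝓘(ℝ, ℝ) ℝ)) :=
    contMDiff_vectorSpace_iff_contDiff.2 contDiff_const
  have h0 : ContMDiff J J.tangent ∞ (fun x : N => (⟨x, 0⟩ : TangentBundle J N)) :=
    Bundle.contMDiff_zeroSection ℝ (TangentSpace J : N → Type _)
  have hs : ContMDiff (𝓘(ℝ, ℝ).prod J) (𝓘(ℝ, ℝ).prod J).tangent ∞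
      (fun p : ℝ × N => (⟨p, ((1 : ℝ), (0 : E))⟩ : TangentBundle (𝓘(ℝ, ℝ).prod J) (ℝ × N))) :=
    contMDiff_equivTangentBundleProd_symm.comp (h1.prodMap h0)
  refine (hT.comp hs.contMDiffOn (fun p hp => hp)).congr fun p hp => ?_
  refine congrArg (Bundle.TotalSpace.mk (F p)) ?_
  have hD := ((hF p hp).mdifferentiableWithinAt (by simp)).hasMFDerivWithinAt
  have h := HasMFDerivWithinAt.comp p.1 (g := F) (f := fun τ : ℝ => (τ, p.2)) hD
    ((hasMFDerivWithinAt_id (I := 𝓘(ℝ, ℝ)) (Icc (0 : ℝ) 1) p.1).prodMk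
      (hasMFDerivWithinAt_const (I' := J) p.2 (Icc (0 : ℝ) 1) p.1))
    (fun τ hτ => ⟨hτ, hp.2⟩)
  exact congrArg (fun L => L (1 : ℝ)) (h.mfderivWithin (hI p.1 hp.1))

/-- A smooth function on `[0,1] × S` with `S` compact is Lipschitz in time, uniformly on `S`. -/
theorem exists_time_lipschitz_bound {S : Set N} (hS : UniqueMDiffOn J S) (hc : IsCompact S)
    {F : ℝ × N → ℝ} (hF : ContMDiffOn (𝓘(ℝ, ℝ).prod J) 𝓘(ℝ, ℝ) ∞ F (Icc (0 : ℝ) 1 ×ˢ S)) :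
    ∃ C : ℝ, ∀ u ∈ Icc (0 : ℝ) 1, ∀ z ∈ S, |F (u, z) - F (0, z)| ≤ C * u := by
  -- The time derivative is continuous on the compact set `[0,1] × S`, hence bounded; the mean value
  -- inequality turns the bound into a Lipschitz constant.
  have hd := (contMDiff_snd_tangentBundle_modelSpace (n := ∞) ℝ 𝓘(ℝ, ℝ)).comp_contMDiffOn
    (contMDiffOn_timeDeriv hS hF)
  obtain ⟨C, hC⟩ := (isCompact_Icc.prod hc).exists_bound_of_continuousOn hd.continuousOn
  refine ⟨C, fun u hu z hz => ?_⟩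
  have hsm : ContDiffOn ℝ ∞ (fun τ : ℝ => F (τ, z)) (Icc 0 1) := by
    rw [← contMDiffOn_iff_contDiffOn]
    exact hF.comp (contMDiff_id.prodMk contMDiff_const).contMDiffOn (fun τ hτ => ⟨hτ, hz⟩)
  have h := (convex_Icc (0 : ℝ) 1).norm_image_sub_le_of_norm_derivWithin_le
    (f := fun τ : ℝ => F (τ, z)) (C := C) (hsm.differentiableOn (by simp))
    (fun τ hτ => by
      have := hC (τ, z) ⟨hτ, hz⟩
      simp only [mfderivWithin_eq_fderivWithin] at this
      exact this) (left_mem_Icc.2 zero_le_one) hu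
  rwa [Real.norm_eq_abs, Real.norm_eq_abs, sub_zero, abs_of_nonneg hu.1] at h

end TimeDerivative

theorem ContactForm.contMDiffOn_apply {n : ℕ} {M : Type*} [TopologicalSpace M]
    [ChartedSpace (EuclideanSpace ℝ (Fin (2 * n + 1))) M] [IsManifold (𝓡 (2 * n + 1)) ∞ M]
    (α : ContactForm n M) {E H N : Type*} [NormedAddCommGroup E] [NormedSpace ℝ E]
    [TopologicalSpace H] {J : ModelWithCorners ℝ E H} [TopologicalSpace N] [ChartedSpace H N]
    {S : Set N} {F : N → M} {v : ∀ z, TangentSpace (𝓡 (2 * n + 1)) (F z)}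
    (hv : ContMDiffOn J (𝓡 (2 * n + 1)).tangent ∞
      (fun z => (⟨F z, v z⟩ : TangentBundle (𝓡 (2 * n + 1)) M)) S) :
    ContMDiffOn J 𝓘(ℝ, ℝ) ∞ (fun z => α.toFun (F z) (v z)) S := by
  have hF : ContMDiffOn J (𝓡 (2 * n + 1)) ∞ F S :=
    (Bundle.contMDiff_proj (TangentSpace (𝓡 (2 * n + 1)) : M → Type _)).comp_contMDiffOn hv
  have h := ContMDiffOn.clm_bundle_apply (E₂ := Bundle.Trivial M ℝ) (F₂ := ℝ)
    (α.smooth.comp_contMDiffOn hF) hv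
  exact fun z hz => (Bundle.contMDiffWithinAt_totalSpace.1 (h z hz)).2

end ContactOrder

/-! ### The contact form along curves -/

namespace ContactOrder

variable {n : ℕ} {M : Type*} [TopologicalSpace M]
  [ChartedSpace (EuclideanSpace ℝ (Fin (2 * n + 1))) M] [IsManifold (𝓡 (2 * n + 1)) ∞ M]

/-- The value of `α` on the velocity at time `t` of a curve defined on `[0,1]`. -/
noncomputable def ContactForm.onVelocity (α : ContactForm n M) (γ : ℝ → M) (t : ℝ) : ℝ :=
  α.toFun (γ t) (mfderivWithin 𝓘(ℝ, ℝ) (𝓡 (2 * n + 1)) γ (Icc (0 : ℝ) 1) t (1 : ℝ))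

namespace ContactForm

variable (α : ContactForm n M)

/-- All tangent spaces are the model space by definition, so the base point and the vector may be
replaced independently, without transport between fibres. -/
theorem toFun_congr {x y : M} (h : x = y) {v w : EuclideanSpace ℝ (Fin (2 * n + 1))}
    (hv : v = w) : α.toFun x v = α.toFun y w := by
  subst h hv; rfl

theorem onVelocity_congr {γ γ' : ℝ → M} (h : EqOn γ γ' (Icc 0 1)) {t : ℝ}
    (ht : t ∈ Icc (0 : ℝ) 1) : α.onVelocity γ t = α.onVelocity γ' t :=
  α.toFun_congr (h ht) (congrArg (fun L : ℝ →L[ℝ] EuclideanSpace ℝ (Fin (2 * n + 1)) => L 1)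
    (mfderivWithin_congr h (h ht)))

theorem contMDiffOn_onVelocity {E H N : Type*} [NormedAddCommGroup E] [NormedSpace ℝ E]
    [TopologicalSpace H] {J : ModelWithCorners ℝ E H} [TopologicalSpace N] [ChartedSpace H N]
    [IsManifold J ∞ N] {S : Set N} (hS : UniqueMDiffOn J S) {F : ℝ × N → M}
    (hF : ContMDiffOn (𝓘(ℝ, ℝ).prod J) (𝓡 (2 * n + 1)) ∞ F (Icc (0 : ℝ) 1 ×ˢ S)) :
    ContMDiffOn (𝓘(ℝ, ℝ).prod J) 𝓘(ℝ, ℝ) ∞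
      (fun p => α.onVelocity (fun τ => F (τ, p.2)) p.1) (Icc (0 : ℝ) 1 ×ˢ S) :=
  α.contMDiffOn_apply (contMDiffOn_timeDeriv hS hF)

variable {α}

theorem onVelocity_contactomorphism_comp (f : Contactomorphism α) {γ : ℝ → M} {t : ℝ}
    (hγ : MDifferentiableWithinAt 𝓘(ℝ, ℝ) (𝓡 (2 * n + 1)) γ (Icc (0 : ℝ) 1) t)
    (ht : t ∈ Icc (0 : ℝ) 1) :
    α.onVelocity (fun τ => f.toDiffeo (γ τ)) t = α.toFun (f.toDiffeo (γ t))
      (mfderiv (𝓡 (2 * n + 1)) (𝓡 (2 * n + 1)) f.toDiffeo (γ t)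
        (mfderivWithin 𝓘(ℝ, ℝ) (𝓡 (2 * n + 1)) γ (Icc (0 : ℝ) 1) t (1 : ℝ))) := by
  have hU : UniqueMDiffWithinAt 𝓘(ℝ, ℝ) (Icc (0 : ℝ) 1) t :=
    (uniqueDiffOn_Icc zero_lt_one t ht).uniqueMDiffWithinAt
  have h := (f.toDiffeo.mdifferentiable (by simp) (γ t)).hasMFDerivAt.comp_hasMFDerivWithinAt t
    hγ.hasMFDerivWithinAt
  exact α.toFun_congr rfl (congrArg
    (fun L : ℝ →L[ℝ] EuclideanSpace ℝ (Fin (2 * n + 1)) => L 1) (h.mfderivWithin hU))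

theorem exists_onVelocity_contactomorphism_comp (f : Contactomorphism α) {γ : ℝ → M} {t : ℝ}
    (hγ : MDifferentiableWithinAt 𝓘(ℝ, ℝ) (𝓡 (2 * n + 1)) γ (Icc (0 : ℝ) 1) t)
    (ht : t ∈ Icc (0 : ℝ) 1) :
    ∃ c : ℝ, 0 < c ∧ α.onVelocity (fun τ => f.toDiffeo (γ τ)) t = c * α.onVelocity γ t := by
  obtain ⟨c, hc, hcv⟩ := f.conformal (γ t)
  exact ⟨c, hc, (onVelocity_contactomorphism_comp f hγ ht).trans (hcv _)⟩

end ContactForm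

variable {α : ContactForm n M}

theorem toI_zero : toI 0 = 0 := projIcc_left zero_le_one

theorem toI_one : toI 1 = 1 := projIcc_right zero_le_one

theorem coe_toI {t : ℝ} (ht : t ∈ Icc (0 : ℝ) 1) : ((toI t : unitInterval) : ℝ) = t :=
  congrArg Subtype.val (projIcc_of_mem zero_le_one ht)

/-! ### Pointwise inverses of contact isotopies -/

/-- The inverse contactomorphism. -/
noncomputable instance : Inv (Contactomorphism α) where
  inv f :=
    { toDiffeo := f.toDiffeo.symm
      conformal := fun x => by
        obtain ⟨c, hc, hcv⟩ := f.conformal (f.toDiffeo.symm x)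
        refine ⟨c⁻¹, inv_pos.2 hc, fun v => ?_⟩
        have h := HasMFDerivAt.comp x
          (f.toDiffeo.mdifferentiable (by simp) (f.toDiffeo.symm x)).hasMFDerivAt
          (f.toDiffeo.symm.mdifferentiable (by simp) x).hasMFDerivAt
        have hid : HasMFDerivAt (𝓡 (2 * n + 1)) (𝓡 (2 * n + 1)) (f.toDiffeo ∘ f.toDiffeo.symm) x
            (ContinuousLinearMap.id ℝ (TangentSpace (𝓡 (2 * n + 1)) x)) :=
          (hasMFDerivAt_id (I := 𝓡 (2 * n + 1)) x).congr_of_eventuallyEq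
            (Filter.Eventually.of_forall fun y => f.toDiffeo.apply_symm_apply y)
        have h' := congrArg (fun L : EuclideanSpace ℝ (Fin (2 * n + 1)) →L[ℝ]
          EuclideanSpace ℝ (Fin (2 * n + 1)) => L v) (hasMFDerivAt_unique h hid)
        have h2 := hcv (mfderiv (𝓡 (2 * n + 1)) (𝓡 (2 * n + 1)) f.toDiffeo.symm x v)
        rw [eq_inv_mul_iff_mul_eq₀ hc.ne']
        exact h2.symm.trans (α.toFun_congr (f.toDiffeo.apply_symm_apply x) h') }

namespace ContactIsotopy

/-- The isotopy of inverses. -/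
noncomputable instance : Inv (ContactIsotopy α) where
  inv φ :=
    { path := fun t => (φ.path t)⁻¹
      path_zero := by rw [φ.path_zero]; exact Contactomorphism.ext fun _ => rfl
      smooth := φ.smooth_symm
      smooth_symm := φ.smooth }

theorem inv_mul_cancel (φ : ContactIsotopy α) : φ⁻¹ * φ = 1 :=
  ContactIsotopy.ext fun t => Contactomorphism.ext fun x =>
    (φ.path t).toDiffeo.symm_apply_apply x

theorem mul_inv_cancel (φ : ContactIsotopy α) : φ * φ⁻¹ = 1 :=
  ContactIsotopy.ext fun t => Contactomorphism.ext fun x =>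
    (φ.path t).toDiffeo.apply_symm_apply x

theorem one_mul (φ : ContactIsotopy α) : 1 * φ = φ :=
  ContactIsotopy.ext fun _ => Contactomorphism.ext fun _ => rfl

/-! ### Hamiltonians in source coordinates, and the product formula -/

/-- The value of `α` on the velocity at time `t` of the trajectory of `x`. -/
noncomputable def lagrangian (φ : ContactIsotopy α) (t : ℝ) (x : M) : ℝ :=
  α.onVelocity (fun τ => (φ.path (toI τ)).toDiffeo x) t

theorem isPositive_iff_lagrangian {φ : ContactIsotopy α} :
    φ.IsPositive ↔ ∀ t ∈ Icc (0 : ℝ) 1, ∀ x, 0 < φ.lagrangian t x :=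
  isPositive_iff.trans ⟨fun h t ht x => h ⟨t, ht⟩ x, fun h t x => h t t.2 x⟩

theorem contMDiffOn_lagrangian (φ : ContactIsotopy α) :
    ContMDiffOn (𝓘(ℝ, ℝ).prod (𝓡 (2 * n + 1))) 𝓘(ℝ, ℝ) ∞
      (fun p : ℝ × M => φ.lagrangian p.1 p.2) (Icc (0 : ℝ) 1 ×ˢ univ) :=
  α.contMDiffOn_onVelocity uniqueMDiffOn_univ φ.smooth

theorem mdifferentiableWithinAt_trajectory (φ : ContactIsotopy α) {t : ℝ}
    (ht : t ∈ Icc (0 : ℝ) 1) (x : M) :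
    MDifferentiableWithinAt 𝓘(ℝ, ℝ) (𝓡 (2 * n + 1)) (fun τ : ℝ => (φ.path (toI τ)).toDiffeo x)
      (Icc (0 : ℝ) 1) t :=
  (φ.hasMFDerivWithinAt_velocity ⟨t, ht⟩ x).mdifferentiableWithinAt

/-- Chain rule. In the second term `φ` is frozen at time `t`, and the conformal factor is left
unexpanded because this is the quantity that `exists_transport_lipschitz_bound` controls. -/
theorem lagrangian_mul (φ ψ : ContactIsotopy α) {t : ℝ} (ht : t ∈ Icc (0 : ℝ) 1) (x : M) :
    (φ * ψ).lagrangian t x = φ.lagrangian t ((ψ.path (toI t)).toDiffeo x)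
      + α.onVelocity (fun τ => (φ.path (toI t)).toDiffeo ((ψ.path (toI τ)).toDiffeo x)) t := by
  rw [ContactForm.onVelocity_contactomorphism_comp _
    (ψ.mdifferentiableWithinAt_trajectory ht x) ht]
  exact (congrArg _ (velocity_mul φ ψ ⟨t, ht⟩ x)).trans (map_add _ _ _)

theorem exists_lagrangian_mul (φ ψ : ContactIsotopy α) {t : ℝ} (ht : t ∈ Icc (0 : ℝ) 1) (x : M) :
    ∃ c : ℝ, 0 < c ∧ (φ * ψ).lagrangian t x
      = φ.lagrangian t ((ψ.path (toI t)).toDiffeo x) + c * ψ.lagrangian t x := by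
  obtain ⟨c, hc, h⟩ := ContactForm.exists_onVelocity_contactomorphism_comp (φ.path (toI t))
    (ψ.mdifferentiableWithinAt_trajectory ht x) ht
  exact ⟨c, hc, by rw [lagrangian_mul φ ψ ht, h]; rfl⟩

theorem hamiltonian_eq (φ : ContactIsotopy α) (t : unitInterval) (y : M) :
    φ.hamiltonian t y = φ.lagrangian t ((φ.path t).toDiffeo.symm y) := rfl

/-- At `y = φ_t ψ_t x` the point `ψ_t x` is `φ_t⁻¹ y`, so the first term of the product formula is
exactly the Hamiltonian of `φ` at `y`; the other term is a conformal factor times a positive number.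
-/
theorem hamiltonian_le_mul (φ : ContactIsotopy α) {ψ : ContactIsotopy α} (hψ : ψ.IsPositive)
    (t : unitInterval) (y : M) : φ.hamiltonian t y ≤ (φ * ψ).hamiltonian t y := by
  obtain ⟨c, hc, h⟩ := exists_lagrangian_mul φ ψ t.2 (((φ * ψ).path t).toDiffeo.symm y)
  rw [hamiltonian_eq, hamiltonian_eq, h, toI_coe, mul_path, Contactomorphism.mul_symm_apply,
    Diffeomorph.apply_symm_apply]
  have := isPositive_iff_lagrangian.1 hψ t t.2
  exact le_add_of_nonneg_right (mul_pos hc (this _)).le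

/-! ### Reparametrization in time -/

/-- The reparametrized isotopy `φ_{u(t)}`. -/
noncomputable def reparam (φ : ContactIsotopy α) (u : ℝ → ℝ) (hu : ContDiff ℝ ∞ u)
    (hI : MapsTo u (Icc 0 1) (Icc 0 1)) (h0 : u 0 = 0) : ContactIsotopy α where
  path t := φ.path (toI (u t))
  path_zero := by rw [Set.Icc.coe_zero, h0, toI_zero, φ.path_zero]
  smooth := by
    refine (φ.smooth.comp ((hu.contMDiff.comp contMDiff_fst).prodMk contMDiff_snd).contMDiffOn
      (fun p hp => ⟨hI hp.1, mem_univ _⟩)).congr fun p hp => ?_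
    simp only [coe_toI hp.1, Function.comp_apply]
  smooth_symm := by
    refine (φ.smooth_symm.comp
      ((hu.contMDiff.comp contMDiff_fst).prodMk contMDiff_snd).contMDiffOn
      (fun p hp => ⟨hI hp.1, mem_univ _⟩)).congr fun p hp => ?_
    simp only [coe_toI hp.1, Function.comp_apply]

theorem reparam_path_toI (φ : ContactIsotopy α) {u : ℝ → ℝ} (hu : ContDiff ℝ ∞ u)
    (hI : MapsTo u (Icc 0 1) (Icc 0 1)) (h0 : u 0 = 0) {t : ℝ} (ht : t ∈ Icc (0 : ℝ) 1) :
    (φ.reparam u hu hI h0).path (toI t) = φ.path (toI (u t)) :=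
  congrArg (fun s => φ.path (toI (u s))) (coe_toI ht)

theorem lagrangian_reparam (φ : ContactIsotopy α) {u : ℝ → ℝ} (hu : ContDiff ℝ ∞ u)
    (hI : MapsTo u (Icc 0 1) (Icc 0 1)) (h0 : u 0 = 0) {t : ℝ} (ht : t ∈ Icc (0 : ℝ) 1) (x : M) :
    (φ.reparam u hu hI h0).lagrangian t x = deriv u t * φ.lagrangian (u t) x := by
  have hU : UniqueMDiffWithinAt 𝓘(ℝ, ℝ) (Icc (0 : ℝ) 1) t :=
    (uniqueDiffOn_Icc zero_lt_one t ht).uniqueMDiffWithinAt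
  have hd : HasMFDerivAt 𝓘(ℝ, ℝ) 𝓘(ℝ, ℝ) u t (ContinuousLinearMap.toSpanSingleton ℝ (deriv u t)) :=
    ((hu.differentiable (by simp) t).hasDerivAt.hasFDerivAt).hasMFDerivAt
  have h := HasMFDerivWithinAt.comp t
    (φ.mdifferentiableWithinAt_trajectory (hI ht) x).hasMFDerivWithinAt
    hd.hasMFDerivWithinAt hI
  have hc : (φ.reparam u hu hI h0).lagrangian t x
      = α.onVelocity (fun τ => (φ.path (toI (u τ))).toDiffeo x) t :=
    α.onVelocity_congr (fun τ hτ => by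
      exact congrArg (fun f => f.toDiffeo x) (φ.reparam_path_toI hu hI h0 hτ)) ht
  have h' := congrArg (fun L : ℝ →L[ℝ] EuclideanSpace ℝ (Fin (2 * n + 1)) => L 1)
    (h.mfderivWithin hU)
  let L : ℝ →L[ℝ] EuclideanSpace ℝ (Fin (2 * n + 1)) :=
    mfderivWithin 𝓘(ℝ, ℝ) (𝓡 (2 * n + 1)) (fun τ : ℝ => (φ.path (toI τ)).toDiffeo x)
      (Icc (0 : ℝ) 1) (u t)
  have hL : L (ContinuousLinearMap.toSpanSingleton ℝ (deriv u t) 1) = deriv u t • L 1 := by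
    rw [← map_smul, ContinuousLinearMap.toSpanSingleton_apply, smul_eq_mul, smul_eq_mul,
      mul_comm (1 : ℝ)]
  rw [hc]
  exact (α.toFun_congr rfl (h'.trans hL)).trans (map_smul (α.toFun _) _ _)

theorem IsPositive.reparam {φ : ContactIsotopy α} (hφ : φ.IsPositive) {u : ℝ → ℝ}
    (hu : ContDiff ℝ ∞ u) (hI : MapsTo u (Icc 0 1) (Icc 0 1)) (h0 : u 0 = 0)
    (hd : ∀ t ∈ Icc (0 : ℝ) 1, 0 < deriv u t) : (φ.reparam u hu hI h0).IsPositive := by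
  rw [isPositive_iff_lagrangian] at hφ ⊢
  intro t ht x
  rw [lagrangian_reparam φ hu hI h0 ht]
  exact mul_pos (hd t ht) (hφ _ (hI ht) x)

/-- Interpolate affinely between the identity and `u`: the intermediate time changes fix `0` and
`1`, and their derivatives are convex combinations of `1` and `u'`, hence positive. -/
theorem IsPositive.homotopicThrough_reparam {φ : ContactIsotopy α} (hφ : φ.IsPositive) {u : ℝ → ℝ}
    (hu : ContDiff ℝ ∞ u) (hI : MapsTo u (Icc 0 1) (Icc 0 1)) (h0 : u 0 = 0) (h1 : u 1 = 1)
    (hd : ∀ t ∈ Icc (0 : ℝ) 1, 0 < deriv u t) :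
    HomotopicThrough IsPositive φ (φ.reparam u hu hI h0) := by
  let U : ℝ → ℝ → ℝ := fun s t => (1 - s) * t + s * u t
  have hU : ∀ s, ContDiff ℝ ∞ (U s) := fun s =>
    (contDiff_const.mul contDiff_id).add (contDiff_const.mul hu)
  have hUI : ∀ s ∈ Icc (0 : ℝ) 1, MapsTo (U s) (Icc 0 1) (Icc 0 1) := fun s hs t ht =>
    (convex_Icc (0 : ℝ) 1) ht (hI ht) (sub_nonneg.2 hs.2) hs.1 (by ring)
  have hU0 : ∀ s, U s 0 = 0 := fun s => by simp [U, h0]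
  have hU1 : ∀ s, U s 1 = 1 := fun s => by simp [U, h1]
  have hUd : ∀ s ∈ Icc (0 : ℝ) 1, ∀ t ∈ Icc (0 : ℝ) 1, 0 < deriv (U s) t := by
    intro s hs t ht
    have hD : HasDerivAt (U s) ((1 - s) * 1 + s * deriv u t) t :=
      ((hasDerivAt_id t).const_mul (1 - s)).add
        ((hu.differentiable (by simp) t).hasDerivAt.const_mul s)
    rw [hD.deriv]
    exact (convex_Ioi (0 : ℝ)) (mem_Ioi.2 one_pos) (hd t ht) (sub_nonneg.2 hs.2) hs.1 (by ring)
  have hend : ∀ s : unitInterval,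
      (φ.reparam (U s) (hU s) (hUI s s.2) (hU0 s)).path 1 = φ.path 1 := fun s => by
    change φ.path (toI (U s ((1 : unitInterval) : ℝ))) = _
    rw [Set.Icc.coe_one, hU1, toI_one]
  have hone : (φ.reparam u hu hI h0).path 1 = φ.path 1 := by
    change φ.path (toI (u ((1 : unitInterval) : ℝ))) = _
    rw [Set.Icc.coe_one, h1, toI_one]
  refine ⟨hone.symm, fun s => φ.reparam (U s) (hU s) (hUI s s.2) (hU0 s), ?_, ?_, hend,
    fun s => hφ.reparam _ _ _ (hUd s s.2), ?_⟩
  · refine ContactIsotopy.ext fun t => ?_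
    change φ.path (toI (U ((0 : unitInterval) : ℝ) t)) = _
    simp only [U, Set.Icc.coe_zero, sub_zero, _root_.one_mul, zero_mul, add_zero, toI_coe]
  · refine ContactIsotopy.ext fun t => ?_
    change φ.path (toI (U ((1 : unitInterval) : ℝ) t)) = φ.path (toI (u t))
    simp only [U, Set.Icc.coe_one, sub_self, _root_.one_mul, zero_mul, zero_add]
  · have hUs : ContDiff ℝ ∞ (fun q : ℝ × ℝ => U q.1 q.2) :=
      ((contDiff_const.sub contDiff_fst).mul contDiff_snd).add
        (contDiff_fst.mul (hu.comp contDiff_snd))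
    have hs : ContMDiff (𝓘(ℝ, ℝ).prod (𝓘(ℝ, ℝ).prod (𝓡 (2 * n + 1)))) 𝓘(ℝ, ℝ) ∞
        (fun p : ℝ × ℝ × M => U p.1 p.2.1) :=
      hUs.contMDiff.comp
        (contMDiff_fst.prodMk_space (contMDiff_fst.comp contMDiff_snd))
    refine (φ.smooth.comp (hs.prodMk (contMDiff_snd.comp contMDiff_snd)).contMDiffOn
      (fun p hp => ⟨hUI _ hp.1 hp.2.1, mem_univ _⟩)).congr fun p hp => ?_
    change (φ.path (toI (U (toI p.1) (toI p.2.1)))).toDiffeo p.2.2 = _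
    rw [coe_toI hp.1, coe_toI hp.2.1]
    rfl

end ContactIsotopy

end ContactOrder

/-! ### Conjugating a positive isotopy -/

namespace ContactOrder

/-- For `u(t) = (e^{Kt} - 1)/(e^K - 1)` the difference `u' - K u` is the positive constant `K/(e^K -
1)`. -/
theorem exists_exponential_reparam {K : ℝ} (hK : 0 < K) :
    ∃ u : ℝ → ℝ, ContDiff ℝ ∞ u ∧ MapsTo u (Icc 0 1) (Icc 0 1) ∧ u 0 = 0 ∧ u 1 = 1 ∧
      (∀ t, 0 < deriv u t) ∧ ∀ t, K * u t < deriv u t := by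
  have hE : 0 < Real.exp K - 1 := sub_pos.2 (Real.one_lt_exp_iff.2 hK)
  have hD : ∀ t, HasDerivAt (fun t => (Real.exp (K * t) - 1) / (Real.exp K - 1))
      (Real.exp (K * t) * (K * 1) / (Real.exp K - 1)) t := fun t =>
    ((((hasDerivAt_id t).const_mul K).exp).sub_const 1).div_const _
  refine ⟨fun t => (Real.exp (K * t) - 1) / (Real.exp K - 1), ?_, ?_, by simp,
    by simp [hE.ne'], fun t => ?_, fun t => ?_⟩
  · exact ((Real.contDiff_exp.comp (contDiff_const.mul contDiff_id)).sub contDiff_const).div_const _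
  · intro t ht
    refine ⟨div_nonneg (sub_nonneg.2 (Real.one_le_exp (mul_nonneg hK.le ht.1))) hE.le,
      (div_le_one hE).2 (sub_le_sub_right (Real.exp_le_exp.2 ?_) 1)⟩
    exact mul_le_of_le_one_right hK.le ht.2
  · rw [(hD t).deriv]; positivity
  · rw [(hD t).deriv, mul_div_assoc', div_lt_div_iff_of_pos_right hE]
    nlinarith

variable {n : ℕ} {M : Type*} [TopologicalSpace M]
  [ChartedSpace (EuclideanSpace ℝ (Fin (2 * n + 1))) M] [IsManifold (𝓡 (2 * n + 1)) ∞ M]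
  {α : ContactForm n M}

namespace ContactIsotopy

/-- The failure of `ψ_v` to preserve the Hamiltonian of `θ` is Lipschitz in `v`. -/
theorem exists_transport_lipschitz_bound [CompactSpace M] (ψ θ : ContactIsotopy α) :
    ∃ C : ℝ, ∀ v ∈ Icc (0 : ℝ) 1, ∀ t ∈ Icc (0 : ℝ) 1, ∀ x : M,
      |α.onVelocity (fun τ => (ψ.path (toI v)).toDiffeo ((θ.path (toI τ)).toDiffeo x)) t
        - θ.lagrangian t ((θ.path (toI t)).toDiffeo.symm
          ((ψ.path (toI v)).toDiffeo ((θ.path (toI t)).toDiffeo x)))| ≤ C * v := by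
  have hI : UniqueMDiffOn 𝓘(ℝ, ℝ) (Icc (0 : ℝ) 1) :=
    (uniqueDiffOn_Icc zero_lt_one).uniqueMDiffOn
  have hS : UniqueMDiffOn (𝓘(ℝ, ℝ).prod (𝓡 (2 * n + 1))) (Icc (0 : ℝ) 1 ×ˢ (univ : Set M)) :=
    hI.prod uniqueMDiffOn_univ
  have hcomp : ContMDiffOn (𝓘(ℝ, ℝ).prod (𝓘(ℝ, ℝ).prod (𝓡 (2 * n + 1)))) (𝓡 (2 * n + 1)) ∞
      (fun p : ℝ × ℝ × M => (ψ.path (toI p.1)).toDiffeo ((θ.path (toI p.2.1)).toDiffeo p.2.2))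
      (Icc (0 : ℝ) 1 ×ˢ (Icc (0 : ℝ) 1 ×ˢ univ)) :=
    ψ.smooth.comp (contMDiff_fst.contMDiffOn.prodMk
      (θ.smooth.comp contMDiff_snd.contMDiffOn fun p hp => hp.2)) fun p hp => ⟨hp.1, mem_univ _⟩
  -- The velocity is taken in the time `t` of `θ`, but the Lipschitz bound is wanted in the time `v`
  -- of `ψ`; each must be the first variable in turn, hence the swap before and after
  -- differentiating.
  have hswap : ContMDiff (𝓘(ℝ, ℝ).prod (𝓘(ℝ, ℝ).prod (𝓡 (2 * n + 1))))
      (𝓘(ℝ, ℝ).prod (𝓘(ℝ, ℝ).prod (𝓡 (2 * n + 1)))) ∞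
      (fun p : ℝ × ℝ × M => (p.2.1, p.1, p.2.2)) :=
    (contMDiff_fst.comp contMDiff_snd).prodMk
      (contMDiff_fst.prodMk (contMDiff_snd.comp contMDiff_snd))
  have hmaps : MapsTo (fun p : ℝ × ℝ × M => (p.2.1, p.1, p.2.2))
      (Icc (0 : ℝ) 1 ×ˢ (Icc (0 : ℝ) 1 ×ˢ univ)) (Icc (0 : ℝ) 1 ×ˢ (Icc (0 : ℝ) 1 ×ˢ univ)) :=
    fun p hp => ⟨hp.2.1, hp.1, mem_univ _⟩
  have hA := (α.contMDiffOn_onVelocity hS (hcomp.comp hswap.contMDiffOn hmaps)).comp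
    hswap.contMDiffOn hmaps
  have ht : ContMDiffOn (𝓘(ℝ, ℝ).prod (𝓘(ℝ, ℝ).prod (𝓡 (2 * n + 1)))) 𝓘(ℝ, ℝ) ∞
      (fun p : ℝ × ℝ × M => p.2.1) (Icc (0 : ℝ) 1 ×ˢ (Icc (0 : ℝ) 1 ×ˢ univ)) :=
    (contMDiff_fst.comp contMDiff_snd).contMDiffOn
  have hB := θ.contMDiffOn_lagrangian.comp (ht.prodMk
    (θ.smooth_symm.comp (ht.prodMk hcomp) fun p hp => ⟨hp.2.1, mem_univ _⟩))
    fun p hp => ⟨hp.2.1, mem_univ _⟩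
  obtain ⟨C, hC⟩ := exists_time_lipschitz_bound hS (isCompact_Icc.prod isCompact_univ) (hA.sub hB)
  refine ⟨C, fun v hv t ht x => ?_⟩
  -- The two terms agree at `v = 0` because `ψ_0 = id`, so the Lipschitz estimate bounds their
  -- difference itself.
  have h0 : α.onVelocity
      (fun τ => (ψ.path (toI 0)).toDiffeo ((θ.path (toI τ)).toDiffeo x)) t
        - θ.lagrangian t ((θ.path (toI t)).toDiffeo.symm
          ((ψ.path (toI 0)).toDiffeo ((θ.path (toI t)).toDiffeo x))) = 0 := by
    simp only [toI_zero, ψ.path_zero, Contactomorphism.one_apply, Diffeomorph.symm_apply_apply]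
    exact sub_self _
  have h := hC v hv (t, x) ⟨ht, mem_univ _⟩
  refine le_trans (le_of_eq (congrArg abs ?_)) h
  exact ((congrArg _ h0).trans (sub_zero _)).symm

/-- A positive isotopy can be reparametrized so that its conjugate by a given isotopy is
positive. -/
theorem IsPositive.exists_conj [CompactSpace M] {ψ : ContactIsotopy α} (hψ : ψ.IsPositive)
    (θ : ContactIsotopy α) :
    ∃ ψ' ρ : ContactIsotopy α, ψ'.IsPositive ∧ ρ.IsPositive ∧ HomotopicThrough IsPositive ψ ψ' ∧
      ψ' * θ = θ * ρ := by
  obtain ⟨C, hC⟩ := exists_transport_lipschitz_bound ψ θ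
  have hψl := isPositive_iff_lagrangian.1 hψ
  obtain ⟨c, hc, hcψ⟩ := (isCompact_Icc.prod isCompact_univ).exists_forall_le'
    ψ.contMDiffOn_lagrangian.continuousOn (a := 0) (fun p hp => hψl p.1 hp.1 p.2)
  -- Chosen so that `K c = |C| + 1`; this exceeds `C` and keeps `K` positive whatever the sign of
  -- `C`.
  have hK : 0 < (|C| + 1) / c := by positivity
  obtain ⟨u, hu, hI, h0, h1, hd, hKu⟩ := exists_exponential_reparam hK
  have hψ' := hψ.reparam hu hI h0 fun t _ => hd t
  have hmul : ψ.reparam u hu hI h0 * θ = θ * (θ⁻¹ * (ψ.reparam u hu hI h0 * θ)) := by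
    rw [← ContactIsotopy.mul_assoc θ, mul_inv_cancel, one_mul]
  refine ⟨_, θ⁻¹ * (ψ.reparam u hu hI h0 * θ), hψ', ?_,
    hψ.homotopicThrough_reparam hu hI h0 h1 fun t _ => hd t, hmul⟩
  rw [isPositive_iff_lagrangian]
  intro t ht x
  -- Expand both sides of `ψ' θ = θ ρ` by the product formula. The result expresses `k` times the
  -- value for `ρ` as the velocity term of `ψ'` plus the transport error.
  obtain ⟨k, hk, hkρ⟩ := exists_lagrangian_mul θ (θ⁻¹ * (ψ.reparam u hu hI h0 * θ)) ht x
  rw [← hmul, lagrangian_mul _ _ ht, lagrangian_reparam ψ hu hI h0 ht] at hkρ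
  have hρ : ((θ⁻¹ * (ψ.reparam u hu hI h0 * θ)).path (toI t)).toDiffeo x
      = (θ.path (toI t)).toDiffeo.symm
          ((ψ.path (toI (u t))).toDiffeo ((θ.path (toI t)).toDiffeo x)) :=
    congrArg (fun f : Contactomorphism α => (θ.path (toI t)).toDiffeo.symm
      (f.toDiffeo ((θ.path (toI t)).toDiffeo x))) (ψ.reparam_path_toI hu hI h0 ht)
  rw [hρ, ψ.reparam_path_toI hu hI h0 ht] at hkρ
  have h2 := (abs_le.1 (hC (u t) (hI ht) t ht x)).1
  have h3 : deriv u t * c ≤ deriv u t * ψ.lagrangian (u t) ((θ.path (toI t)).toDiffeo x) :=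
    mul_le_mul_of_nonneg_left (hcψ (u t, _) ⟨hI ht, mem_univ _⟩) (hd t).le
  have h4 : (|C| + 1) * u t < deriv u t * c := by
    have := mul_lt_mul_of_pos_right (hKu t) hc
    rwa [div_mul_eq_mul_div, div_mul_cancel₀ _ hc.ne'] at this
  have h5 : C * u t ≤ |C| * u t := mul_le_mul_of_nonneg_right (le_abs_self C) (hI ht).1
  have h6 := (hI ht).1
  -- The velocity term is at least `u' c > (|C| + 1) u`, and the error is at least `-C u ≥ -|C| u`;
  -- since `u ≥ 0`, the sum is positive.
  exact pos_of_mul_pos_right (by linarith : 0 < k * _) hk.le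

end ContactIsotopy

open ContactIsotopy

/-! ### Moving classes past each other, and cancellation -/

namespace PosClass

/-- Substitute for conjugation by `c`, whose inverse need not be a positive class: the
reparametrized `ψ'` still represents `d`, and its conjugate `ρ` represents `d'`. -/
theorem exists_mul_eq_mul [CompactSpace M] (d c : PosClass α) : ∃ d' : PosClass α,
    d * c = c * d' := by
  rcases d with ⟨ψ⟩
  rcases c with ⟨θ⟩
  obtain ⟨ψ', ρ, hψ', hρ, hh, hm⟩ := ψ.2.exists_conj θ.1
  refine ⟨Quot.mk _ ⟨ρ, hρ⟩, ?_⟩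
  have h : (Quot.mk _ ψ : PosClass α) = Quot.mk _ ⟨ψ', hψ'⟩ := Quot.sound hh
  let c : PosClass α := Quot.mk _ θ
  have hm' : (⟨ψ' * θ.1, hψ'.mul θ.2⟩ : PosIsotopy α) = ⟨θ.1 * ρ, θ.2.mul hρ⟩ := Subtype.ext hm
  exact (congrArg (fun b : PosClass α => b * c) h).trans (congrArg (Quot.mk _) hm')

/-- Cancelling `a` is possible only after projecting, where it yields `π(e) = 1` and contradicts
orderability. -/
theorem mul_ne_self (hα : IsOrderable α) (a e : PosClass α) : a * e ≠ a := by
  rcases a with ⟨φ⟩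
  rcases e with ⟨ψ⟩
  intro h
  -- Left translation by the inverse isotopy descends to classes, since it carries homotopies of
  -- contact isotopies to such homotopies.
  let f : IsotopyClass α → IsotopyClass α :=
    Quot.map (φ.1⁻¹ * ·) fun _ _ h => h.mul_left _ fun _ _ => trivial
  refine hα ⟨Quot.mk _ ψ, ?_⟩
  have h' : (Quot.mk _ (φ.1⁻¹ * (φ.1 * ψ.1)) : IsotopyClass α) = Quot.mk _ (φ.1⁻¹ * φ.1) :=
    congrArg (fun b => f (proj α b)) h
  rw [← ContactIsotopy.mul_assoc, ContactIsotopy.inv_mul_cancel, ContactIsotopy.one_mul] at h'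
  exact h'

end PosClass

/-! ### The order and its projection -/

theorem GePos.isBiInvariantPartialOrder [CompactSpace M] (hα : IsOrderable α) :
    IsBiInvariantPartialOrder (GePos : PosClass α → PosClass α → Prop) where
  refl a := Or.inl rfl
  antisymm := by
    rintro a b (h | ⟨c, rfl⟩) (h' | ⟨d, hd⟩)
    · exact h
    · exact h
    · exact h'.symm
    · rw [mul_assoc] at hd
      exact absurd hd.symm (PosClass.mul_ne_self hα b _)
  trans := by
    rintro a b c (rfl | ⟨d, rfl⟩) (rfl | ⟨e, rfl⟩)
    · exact Or.inl rfl
    · exact Or.inr ⟨e, rfl⟩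
    · exact Or.inr ⟨d, rfl⟩
    · exact Or.inr ⟨e * d, mul_assoc _ _ _⟩
  mul_right := by
    rintro a b c (rfl | ⟨d, rfl⟩)
    · exact Or.inl rfl
    · obtain ⟨d', h⟩ := PosClass.exists_mul_eq_mul d c
      -- `(bd)c = b(dc) = b(cd') = (bc)d'`.
      exact Or.inr ⟨d', by rw [mul_assoc, h, mul_assoc]⟩
  mul_left := by
    rintro a b c (rfl | ⟨d, rfl⟩)
    · exact Or.inl rfl
    · exact Or.inr ⟨d, (mul_assoc _ _ _).symm⟩

theorem GePos.geOrd_proj {a b : PosClass α} (h : GePos a b) : GeOrd (proj α a) (proj α b) := by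
  rcases b with ⟨φ⟩
  rcases h with rfl | ⟨⟨ψ⟩, rfl⟩
  · exact ⟨φ.1, φ.1, rfl, rfl, fun _ _ => le_rfl⟩
  · exact ⟨φ.1 * ψ.1, φ.1, rfl, rfl, hamiltonian_le_mul φ.1 ψ.2⟩

end ContactOrder

theorem mainTheorem1 {n : ℕ} {M : Type*} [TopologicalSpace M]
    [ChartedSpace (EuclideanSpace ℝ (Fin (2 * n + 1))) M]
    [IsManifold (modelWithCornersSelf ℝ (EuclideanSpace ℝ (Fin (2 * n + 1)))) ∞ M]
    [T2Space M] [CompactSpace M]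
    (α : ContactOrder.ContactForm n M) (hα : ContactOrder.IsOrderable α) :
    ContactOrder.IsBiInvariantPartialOrder
        (ContactOrder.GePos : ContactOrder.PosClass α → ContactOrder.PosClass α → Prop) ∧
      ∀ a b : ContactOrder.PosClass α, ContactOrder.GePos a b →
        ContactOrder.GeOrd (ContactOrder.proj α a) (ContactOrder.proj α b) :=
  ⟨ContactOrder.GePos.isBiInvariantPartialOrder hα, fun _ _ => ContactOrder.GePos.geOrd_proj⟩
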